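/- Let $N$ be a natural number and $\mathcal U$ a complex Hilbert space; $L(\mathcal V)$ denotes the bounded linear operators on a Hilbert space $\mathcal V$. Put $\mathbb D^N=\{w\in\mathbb C^N: |w_k|<1,\ k=1,\dots,N\}$, $\Pi^N=\{z\in\mathbb C^N:\operatorname{Re} z_k>0,\ k=1,\dots,N\}$ and $\Omega_N=\bigcup_{|\lambda|=1}\lambda\,\Pi^N$. The Bessmertnyĭ class $\mathcal B_N(\mathcal U)$ consists of the holomorphic functions $f:\Omega_N\to L(\mathcal U)$ for which there are a Hilbert space $\mathcal H$ and positive semidefinite operators $A_1,\dots,A_N\in L(\mathcal U\oplus\mathcal H)$ such that, writing $$z_1A_1+\cdots+z_NA_N=\begin{pmatrix}a(z)&b(z)\\ c(z)&d(z)\end{pmatrix},$$ the operator $d(z)\in L(\mathcal H)$ is boundedly invertible and $f(z)=a(z)-b(z)d(z)^{-1}c(z)$ for all $z\in\Omega_N$. The double Cayley transform of $f\in\mathcal B_N(\mathcal U)$ is the function $$\mathcal C(f)(w)=\bigl(F(w)-I\bigr)\bigl(F(w)+I\bigr)^{-1},\qquad F(w)=f\Bigl(\frac{1+w_1}{1-w_1},\dots,\frac{1+w_N}{1-w_N}\Bigr),\qquad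 w\in\mathbb D^N$$ (the inverse always exists). An Agler unitary colligation $\alpha$ (with input and output space $\mathcal U$) consists of Hilbert spaces $\mathcal X_1,\dots,\mathcal X_N$ with orthogonal direct sum $\mathcal X=\bigoplus_{k=1}^N\mathcal X_k$, and a unitary operator $U=\begin{pmatrix}A&B\\ C&D\end{pmatrix}\in L(\mathcal X\oplus\mathcal U)$. Its transfer function is $$\mathcal F_\alpha(w)=D+CP(w)\bigl(I-AP(w)\bigr)^{-1}B,\qquad P(w)=\sum_{k=1}^N w_kP_{\mathcal X_k},\qquad w\in\mathbb D^N,$$ where $P_{\mathcal X_k}$ is the orthogonal projection of $\mathcal X$ onto $\mathcal X_k$ (the inverse always exists). **Theorem.** Let $\mathcal F:\mathbb D^N\to L(\mathcal U)$ be holomorphic. Then $\mathcal F=\mathcal C(f)$ for some $f\in\mathcal B_N(\mathcal U)$ if and only if both of the following conditions hold: (i) $\mathcal F=\mathcal F_\alpha$ on $\mathbb D^N$ for an Agler unitary colligation $\alpha$ whose colligation operator satisfies $U=U^*$; (ii) $1\notin\sigma(\mathcal F(0))$. -/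

import Mathlib

noncomputable section

namespace Bessmertnyi

universe u

/-- The unit polydisk `𝔻^N`. -/
def polydisk (N : ℕ) : Set (Fin N → ℂ) := {w | ∀ k, ‖w k‖ < 1}

/-- The open right polyhalfplane `Π^N`. -/
def polyhalfplane (N : ℕ) : Set (Fin N → ℂ) := {z | ∀ k, 0 < (z k).re}

/-- The domain `Ω_N = ⋃_{|l| = 1} (l Π)^N`. -/
def Omega (N : ℕ) : Set (Fin N → ℂ) :=
  {z | ∃ l : ℂ, ‖l‖ = 1 ∧ ∃ x ∈ polyhalfplane N, z = l • x}

section Blocks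

variable {V W : Type u} [NormedAddCommGroup V] [InnerProductSpace ℂ V]
  [NormedAddCommGroup W] [InnerProductSpace ℂ W]

/-- The isometric inclusion `v ↦ (v, 0)` into the Hilbert space direct sum `V ⊕ W`. -/
def incl₁ : V →L[ℂ] WithLp 2 (V × W) :=
  (WithLp.prodContinuousLinearEquiv 2 ℂ V W).symm.toContinuousLinearMap ∘L
    ContinuousLinearMap.inl ℂ V W

/-- The isometric inclusion `w ↦ (0, w)` into the Hilbert space direct sum `V ⊕ W`. -/
def incl₂ : W →L[ℂ] WithLp 2 (V × W) :=
  (WithLp.prodContinuousLinearEquiv 2 ℂ V W).symm.toContinuousLinearMap ∘L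
    ContinuousLinearMap.inr ℂ V W

/-- The block `V → V` of an operator on `V ⊕ W`. -/
def block₁₁ (T : WithLp 2 (V × W) →L[ℂ] WithLp 2 (V × W)) : V →L[ℂ] V :=
  WithLp.fstL 2 ℂ V W ∘L T ∘L incl₁

/-- The block `W → V` of an operator on `V ⊕ W`. -/
def block₁₂ (T : WithLp 2 (V × W) →L[ℂ] WithLp 2 (V × W)) : W →L[ℂ] V :=
  WithLp.fstL 2 ℂ V W ∘L T ∘L incl₂

/-- The block `V → W` of an operator on `V ⊕ W`. -/
def block₂₁ (T : WithLp 2 (V × W) →L[ℂ] WithLp 2 (V × W)) : V →L[ℂ] W :=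
  WithLp.sndL 2 ℂ V W ∘L T ∘L incl₁

/-- The block `W → W` of an operator on `V ⊕ W`. -/
def block₂₂ (T : WithLp 2 (V × W) →L[ℂ] WithLp 2 (V × W)) : W →L[ℂ] W :=
  WithLp.sndL 2 ℂ V W ∘L T ∘L incl₂

end Blocks

/-- The homogeneous linear pencil `A(z) = z₁ A₁ + ⋯ + z_N A_N`. -/
def pencil {N : ℕ} {E : Type u} [NormedAddCommGroup E] [InnerProductSpace ℂ E]
    (A : Fin N → (E →L[ℂ] E)) (z : Fin N → ℂ) : E →L[ℂ] E :=
  ∑ k, z k • A k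

/-- The Bessmertnyi class `B_N(U)`: holomorphic functions on `Ω_N` of the form
`f(z) = a(z) - b(z) d(z)⁻¹ c(z)`, where `a(z), b(z), c(z), d(z)` are the blocks of a linear pencil
on `U ⊕ H` with positive semidefinite coefficients and `d(z)` is boundedly invertible on `Ω_N`. -/
def IsBessmertnyi {N : ℕ} {U : Type u} [NormedAddCommGroup U] [InnerProductSpace ℂ U]
    (f : (Fin N → ℂ) → (U →L[ℂ] U)) : Prop :=
  DifferentiableOn ℂ f (Omega N) ∧
  ∃ (H : Type u) (_ : NormedAddCommGroup H) (_ : InnerProductSpace ℂ H) (_ : CompleteSpace H)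
    (A : Fin N → (WithLp 2 (U × H) →L[ℂ] WithLp 2 (U × H))),
    (∀ k, (A k).IsPositive) ∧
    ∀ z ∈ Omega N,
      IsUnit (block₂₂ (pencil A z)) ∧
      f z = block₁₁ (pencil A z) -
        block₁₂ (pencil A z) ∘L Ring.inverse (block₂₂ (pencil A z)) ∘L block₂₁ (pencil A z)

/-- The Cayley transform of the variables, mapping `𝔻^N` onto `Π^N`. -/
def cayleyVar {N : ℕ} (w : Fin N → ℂ) : Fin N → ℂ := fun k => (1 + w k) / (1 - w k)

/-- The double Cayley transform `C(f)(w) = (F(w) - I)(F(w) + I)⁻¹`, where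
`F(w) = f((1 + w₁)/(1 - w₁), …, (1 + w_N)/(1 - w_N))`, to be read for `w ∈ 𝔻^N`. The inverse
exists there when `f` is in the Bessmertnyi class, see `isUnit_add_one`. -/
def doubleCayley {N : ℕ} {U : Type u} [NormedAddCommGroup U] [InnerProductSpace ℂ U]
    (f : (Fin N → ℂ) → (U →L[ℂ] U)) (w : Fin N → ℂ) : U →L[ℂ] U :=
  (f (cayleyVar w) - 1) * Ring.inverse (f (cayleyVar w) + 1)

/-- An Agler unitary colligation `(N; op; X = ⨁ X_k, U, U)`: Hilbert spaces `X₁, …, X_N` and a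
unitary operator `op` on `X ⊕ U`, where `X` is the Hilbert space direct sum of the `X_k`. -/
structure AglerUnitaryColligation (N : ℕ) (U : Type u) [NormedAddCommGroup U]
    [InnerProductSpace ℂ U] [CompleteSpace U] where
  X : Fin N → Type u
  [normedAddCommGroup : ∀ k, NormedAddCommGroup (X k)]
  [innerProductSpace : ∀ k, InnerProductSpace ℂ (X k)]
  [completeSpace : ∀ k, CompleteSpace (X k)]
  op : WithLp 2 (PiLp 2 X × U) →L[ℂ] WithLp 2 (PiLp 2 X × U)
  unitary_op : op ∈ unitary (WithLp 2 (PiLp 2 X × U) →L[ℂ] WithLp 2 (PiLp 2 X × U))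

namespace AglerUnitaryColligation

attribute [instance] AglerUnitaryColligation.normedAddCommGroup
attribute [instance] AglerUnitaryColligation.innerProductSpace
attribute [instance] AglerUnitaryColligation.completeSpace

variable {N : ℕ} {U : Type u} [NormedAddCommGroup U] [InnerProductSpace ℂ U] [CompleteSpace U]
  (α : AglerUnitaryColligation N U)

/-- The state space `X = ⨁ X_k`. -/
abbrev State : Type u := PiLp 2 α.X

/-- The orthogonal projection of the state space onto its summand `X_k`. -/
def proj (k : Fin N) : α.State →L[ℂ] α.State :=
  (PiLp.continuousLinearEquiv 2 ℂ α.X).symm.toContinuousLinearMap ∘L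
    ContinuousLinearMap.single ℂ α.X k ∘L PiLp.proj 2 α.X k

/-- `P(w) = ∑ w_k P_{X_k}`. -/
def P (w : Fin N → ℂ) : α.State →L[ℂ] α.State := ∑ k, w k • α.proj k

/-- The block `A : X → X` of the colligation operator. -/
def A : α.State →L[ℂ] α.State := block₁₁ α.op

/-- The block `B : U → X` of the colligation operator. -/
def B : U →L[ℂ] α.State := block₁₂ α.op

/-- The block `C : X → U` of the colligation operator. -/
def C : α.State →L[ℂ] U := block₂₁ α.op

/-- The block `D : U → U` of the colligation operator. -/
def D : U →L[ℂ] U := block₂₂ α.op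

/-- The transfer function `F_α(w) = D + C P(w) (I - A P(w))⁻¹ B`, to be read for `w ∈ 𝔻^N`, where
the inverse exists, see `isUnit_one_sub`. -/
def transferFunction (w : Fin N → ℂ) : U →L[ℂ] U :=
  α.D + α.C ∘L α.P w ∘L Ring.inverse (1 - α.A * α.P w) ∘L α.B

end AglerUnitaryColligation

/-! ### The inverses in the two definitions above exist -/

section Blocks

variable {V W : Type u} [NormedAddCommGroup V] [InnerProductSpace ℂ V]
  [NormedAddCommGroup W] [InnerProductSpace ℂ W]

theorem apply_toLp (T : WithLp 2 (V × W) →L[ℂ] WithLp 2 (V × W)) (v : V) (w : W) :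
    T (WithLp.toLp 2 (v, w)) =
      WithLp.toLp 2 (block₁₁ T v + block₁₂ T w, block₂₁ T v + block₂₂ T w) := by
  have h : WithLp.toLp 2 (v, w) = incl₁ (W := W) v + incl₂ (V := V) w := by
    apply (WithLp.prodContinuousLinearEquiv 2 ℂ V W).injective
    simp [incl₁, incl₂]
  rw [h, map_add]
  apply (WithLp.prodContinuousLinearEquiv 2 ℂ V W).injective
  simp [block₁₁, block₁₂, block₂₁, block₂₂]
  rfl

end Blocks

theorem cayleyVar_mem {N : ℕ} {w : Fin N → ℂ} (hw : w ∈ polydisk N) :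
    cayleyVar w ∈ polyhalfplane N := by
  intro k
  have h : ‖w k‖ < 1 := hw k
  have h1 : Complex.normSq (w k) < 1 := by
    rw [Complex.normSq_eq_norm_sq]
    nlinarith [norm_nonneg (w k)]
  have h0 : 1 - w k ≠ 0 := by
    intro h0
    rw [← sub_eq_zero.mp h0] at h
    simp at h
  have h2 : 0 < Complex.normSq (1 - w k) := Complex.normSq_pos.mpr h0
  rw [Complex.normSq_apply] at h1
  simp only [cayleyVar, Complex.div_re, Complex.add_re, Complex.one_re, Complex.sub_re,
    Complex.add_im, Complex.one_im, Complex.sub_im]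
  rw [← add_div]
  apply div_pos _ h2
  nlinarith

theorem polyhalfplane_subset (N : ℕ) : polyhalfplane N ⊆ Omega N :=
  fun z hz => ⟨1, by simp, z, hz, by simp⟩

/-- A function of the Bessmertnyi class has positive semidefinite real part on `Π^N`. -/
theorem IsBessmertnyi.re_inner_nonneg {N : ℕ} {U : Type u} [NormedAddCommGroup U]
    [InnerProductSpace ℂ U] {f : (Fin N → ℂ) → (U →L[ℂ] U)} (hf : IsBessmertnyi f)
    {z : Fin N → ℂ} (hz : z ∈ polyhalfplane N) (x : U) :
    0 ≤ (inner ℂ (f z x) x).re := by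
  obtain ⟨-, H, _, _, _, A, hA, hfA⟩ := hf
  obtain ⟨hu, hfz⟩ := hfA z (polyhalfplane_subset N hz)
  set T := pencil A z with hT
  set y : H := -(Ring.inverse (block₂₂ T)) (block₂₁ T x) with hy
  have hd : block₂₂ T y = - block₂₁ T x := by
    have h : (block₂₂ T * Ring.inverse (block₂₂ T)) (block₂₁ T x) = block₂₁ T x := by
      rw [Ring.mul_inverse_cancel _ hu]; rfl
    rw [hy, map_neg]
    exact congrArg Neg.neg h
  have hTv : T (WithLp.toLp 2 (x, y)) = WithLp.toLp 2 (f z x, 0) := by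
    rw [apply_toLp, hd, hfz]
    congr 2
    · simp [hy, sub_eq_add_neg]
    · simp
  have h1 : inner ℂ (f z x) x =
      inner ℂ (T (WithLp.toLp 2 (x, y))) (WithLp.toLp 2 (x, y)) := by
    rw [hTv, WithLp.prod_inner_apply]; simp
  rw [h1, hT, pencil, _root_.sum_apply, sum_inner, Complex.re_sum]
  refine Finset.sum_nonneg fun k _ => ?_
  have h2 := (hA k).inner_nonneg_left (WithLp.toLp 2 (x, y))
  rw [Complex.le_def] at h2
  have h3 := h2.1
  have h4 := h2.2
  simp only [Complex.zero_re, Complex.zero_im] at h3 h4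
  rw [smul_apply, inner_smul_left, Complex.mul_re, ← h4]
  simpa using mul_nonneg (hz k).le h3

/-- If `f` is in the Bessmertnyi class, `f(z) + I` is boundedly invertible for `z ∈ Π^N`. -/
theorem IsBessmertnyi.isUnit_add_one {N : ℕ} {U : Type u} [NormedAddCommGroup U]
    [InnerProductSpace ℂ U] [CompleteSpace U] {f : (Fin N → ℂ) → (U →L[ℂ] U)}
    (hf : IsBessmertnyi f) {z : Fin N → ℂ} (hz : z ∈ polyhalfplane N) : IsUnit (f z + 1) := by
  refine ContinuousLinearMap.isUnit_of_forall_le_norm_inner_map _ (c := 1) one_pos fun x => ?_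
  have h := hf.re_inner_nonneg hz x
  have h1 : (inner ℂ ((f z + 1) x) x).re = (inner ℂ (f z x) x).re + ‖x‖ ^ 2 := by
    rw [add_apply, inner_add_left, Complex.add_re,
      one_apply_eq_self]
    congr 1
    exact inner_self_eq_norm_sq (𝕜 := ℂ) x
  calc ‖x‖ ^ 2 * ((1 : NNReal) : ℝ) ≤ (inner ℂ ((f z + 1) x) x).re := by
        rw [h1]; simpa using h
    _ ≤ ‖inner ℂ ((f z + 1) x) x‖ := Complex.re_le_norm _

namespace AglerUnitaryColligation

variable {N : ℕ} {U : Type u} [NormedAddCommGroup U] [InnerProductSpace ℂ U] [CompleteSpace U]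
  (α : AglerUnitaryColligation N U)

theorem P_apply (w : Fin N → ℂ) (x : α.State) (j : Fin N) : α.P w x j = w j • x j := by
  have h (k : Fin N) : (α.proj k x) j = Pi.single (M := α.X) k (x k) j := rfl
  rw [P, sum_apply, WithLp.ofLp_sum, Finset.sum_apply]
  rw [Finset.sum_eq_single j]
  · rw [smul_apply, PiLp.smul_apply, h, Pi.single_eq_same]
  · intro k _ hk
    rw [smul_apply, PiLp.smul_apply, h, Pi.single_eq_of_ne hk.symm, smul_zero]
  · simp

theorem norm_A_apply_le (x : α.State) : ‖α.A x‖ ≤ ‖x‖ := by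
  have h1 : ‖α.op (incl₁ x)‖ = ‖incl₁ (W := U) x‖ :=
    ContinuousLinearMap.norm_map_of_mem_unitary α.unitary_op _
  have h2 : ‖incl₁ (W := U) x‖ = ‖x‖ := WithLp.norm_toLp_fst 2 _ _ x
  rw [← h2, ← h1]
  exact WithLp.norm_fst_le _ _

theorem isUnit_one_sub {w : Fin N → ℂ} (hw : w ∈ polydisk N) : IsUnit (1 - α.A * α.P w) := by
  obtain ⟨r, hr0, hr1, hr⟩ : ∃ r : ℝ, 0 ≤ r ∧ r < 1 ∧ ∀ k, ‖w k‖ ≤ r := by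
    refine ⟨‖w‖, norm_nonneg _, ?_, norm_le_pi_norm w⟩
    exact (pi_norm_lt_iff one_pos).mpr hw
  have hP (x : α.State) : ‖α.P w x‖ ≤ r * ‖x‖ := by
    rw [← abs_of_nonneg (norm_nonneg (α.P w x)), ← abs_of_nonneg (mul_nonneg hr0 (norm_nonneg x)),
      ← sq_le_sq, mul_pow, PiLp.norm_sq_eq_of_L2, PiLp.norm_sq_eq_of_L2, Finset.mul_sum]
    refine Finset.sum_le_sum fun k _ => ?_
    rw [P_apply, norm_smul, mul_pow]
    have := hr k
    gcongr
  have hn : ‖α.A * α.P w‖ ≤ r :=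
    ContinuousLinearMap.opNorm_le_bound _ hr0 fun x => (α.norm_A_apply_le _).trans (hP x)
  exact isUnit_one_sub_of_norm_lt_one (hn.trans_lt hr1)

end AglerUnitaryColligation

end Bessmertnyi

end

/-! A self-adjoint unitary `α.op` is a reflection, so it is determined by its eigenspace E for `-1`;
the eigenspace for `1` is the orthogonal complement of E. Put z = `cayleyVar w`. If (t, g) lies in E
and (-P(z)t, k) in its complement, adding the two vectors solves the state equations with input k +
g and output k - g. The transfer function is therefore the Cayley transform of the relation g ↦ k
(`transferFunction_add`). Orthogonality to E says that ⟨P(z)t, s⟩ = ⟨k, g'⟩ for all (s, g') in E.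
Once E, or a dense part of it, is written as the vectors (Gv, first component of v) with v in U ⊕ H,
this becomes G*P(z)Gv = (k, 0). Here G*P(z)G is a linear pencil with positive semidefinite
coefficients, and the equation says that k is its Schur complement applied to g. Given a
colligation, invertibility of 1 - D, which is condition (ii) because F(0) = D, makes every g occur
in E, and `eigenState` serves as G. Given f, square roots of the coefficients provide G, and E is
the closure of the resulting vectors. -/

noncomputable section

namespace Bessmertnyi

universe u

open ContinuousLinearMap

/-! ### Schur complements -/

section Blocks

variable {V W : Type u} [NormedAddCommGroup V] [InnerProductSpace ℂ V]
  [NormedAddCommGroup W] [InnerProductSpace ℂ W]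

/-- The Schur complement `a - b d⁻¹ c` of an operator on `V ⊕ W`. -/
def schurComplement (T : WithLp 2 (V × W) →L[ℂ] WithLp 2 (V × W)) : V →L[ℂ] V :=
  block₁₁ T - block₁₂ T ∘L Ring.inverse (block₂₂ T) ∘L block₂₁ T

/-- The Schur complement as elimination: the second component is chosen to annihilate the second
output. Both directions use it in this form. -/
theorem apply_toLp_neg_inverse {T : WithLp 2 (V × W) →L[ℂ] WithLp 2 (V × W)}
    (hT : IsUnit (block₂₂ T)) (v : V) :
    T (WithLp.toLp 2 (v, -(Ring.inverse (block₂₂ T)) (block₂₁ T v))) =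
      WithLp.toLp 2 (schurComplement T v, 0) := by
  have h : block₂₂ T (Ring.inverse (block₂₂ T) (block₂₁ T v)) = block₂₁ T v :=
    DFunLike.congr_fun (Ring.mul_inverse_cancel _ hT) _
  rw [apply_toLp, map_neg, map_neg, h]
  simp [schurComplement, sub_eq_add_neg]

theorem inner_block₂₂ (T : WithLp 2 (V × W) →L[ℂ] WithLp 2 (V × W)) (x y : W) :
    inner ℂ (block₂₂ T x) y = inner ℂ (T (WithLp.toLp 2 (0, x))) (WithLp.toLp 2 (0, y)) := by
  rw [apply_toLp, WithLp.prod_inner_apply]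
  simp

theorem _root_.DifferentiableAt.schurComplement [CompleteSpace W] {E : Type*}
    [NormedAddCommGroup E] [NormedSpace ℂ E] {T : E → WithLp 2 (V × W) →L[ℂ] WithLp 2 (V × W)}
    {z : E} (hT : DifferentiableAt ℂ T z) (hz : IsUnit (block₂₂ (T z))) :
    DifferentiableAt ℂ (fun z => schurComplement (T z)) z := by
  have hi : DifferentiableAt ℂ (fun z => Ring.inverse (block₂₂ (T z))) z :=
    DifferentiableAt.comp (g := Ring.inverse) (f := fun z => block₂₂ (T z)) z
      (differentiableAt_inverse (𝕜 := ℂ) (R := W →L[ℂ] W) hz) (by unfold block₂₂; fun_prop)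
  unfold Bessmertnyi.schurComplement block₁₁ block₁₂ block₂₁
  fun_prop

end Blocks

theorem one_sub_ne_zero_of_norm_lt_one {w : ℂ} (hw : ‖w‖ < 1) : 1 - w ≠ 0 := by
  intro h
  rw [← sub_eq_zero.mp h] at hw
  simp at hw

theorem exists_pos_le_re {N : ℕ} {z : Fin N → ℂ} (hz : z ∈ polyhalfplane N) :
    ∃ r : ℝ, 0 < r ∧ ∀ k, r ≤ (z k).re := by
  rcases isEmpty_or_nonempty (Fin N) with h | h
  -- For N = 0 there is no minimum, and any positive bound serves.
  · exact ⟨1, one_pos, fun k => h.elim k⟩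
  · obtain ⟨k, hk⟩ := Finite.exists_min fun k => (z k).re
    exact ⟨_, hz k, hk⟩

/-- A bounded operator which is both self-adjoint and an involution is unitary. -/
theorem mem_unitary_of_isSelfAdjoint {R : Type*} [Ring R] [StarRing R] {a : R}
    (ha : IsSelfAdjoint a) (h : a * a = 1) : a ∈ unitary R := by
  rw [Unitary.mem_iff, ha.star_eq]
  exact ⟨h, h⟩

/-! ### State equations and the Cayley transform -/

namespace AglerUnitaryColligation

variable {N : ℕ} {U : Type u} [NormedAddCommGroup U] [InnerProductSpace ℂ U] [CompleteSpace U]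
  (α : AglerUnitaryColligation N U)

theorem inner_P (w : Fin N → ℂ) (x y : α.State) :
    inner ℂ (α.P w x) y = ∑ k, (starRingEnd ℂ) (w k) * inner ℂ (x k) (y k) := by
  rw [PiLp.inner_apply]
  refine Finset.sum_congr rfl fun k _ => ?_
  rw [P_apply, inner_smul_left]

theorem inner_proj (k : Fin N) (x y : α.State) :
    inner ℂ (α.proj k x) y = inner ℂ (x k) (y k) := by
  have h (j : Fin N) : (α.proj k x) j = Pi.single (M := α.X) k (x k) j := rfl
  rw [PiLp.inner_apply, Finset.sum_eq_single k]
  · rw [h, Pi.single_eq_same]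
  · intro j _ hj
    rw [h, Pi.single_eq_of_ne hj, inner_zero_left]
  · simp

theorem le_norm_inner_P {z : Fin N → ℂ} {r : ℝ} (hr : ∀ k, r ≤ (z k).re) (x : α.State) :
    r * ‖x‖ ^ 2 ≤ ‖inner ℂ (α.P z x) x‖ := by
  refine le_trans ?_ (Complex.re_le_norm _)
  rw [inner_P, Complex.re_sum, PiLp.norm_sq_eq_of_L2, Finset.mul_sum]
  refine Finset.sum_le_sum fun k _ => ?_
  have h : inner ℂ (x k) (x k) = ((‖x k‖ ^ 2 : ℝ) : ℂ) := by
    rw [inner_self_eq_norm_sq_to_K]; simp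
  rw [h, Complex.re_mul_ofReal, Complex.conj_re]
  exact mul_le_mul_of_nonneg_right (hr k) (sq_nonneg _)

theorem transferFunction_zero : α.transferFunction 0 = α.D := by
  have hP : α.P 0 = 0 := by
    ext x j
    rw [P_apply, Pi.zero_apply, zero_smul]
    rfl
  rw [transferFunction, hP, zero_comp, comp_zero, add_zero]

/-- A solution of the state equations determines the value of the transfer function. -/
theorem transferFunction_apply {w : Fin N → ℂ} (hw : w ∈ polydisk N) {x : α.State} {u y : U}
    (h : α.op (WithLp.toLp 2 (α.P w x, u)) = WithLp.toLp 2 (x, y)) :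
    α.transferFunction w u = y := by
  rw [apply_toLp] at h
  have h' := (WithLp.toLp_injective 2) h
  rw [Prod.mk.injEq] at h'
  obtain ⟨h1, h2⟩ := h'
  have hB : α.B u = (1 - α.A * α.P w) x := by
    exact eq_sub_of_add_eq' h1
  have hx : Ring.inverse (1 - α.A * α.P w) (α.B u) = x := by
    rw [hB]
    exact DFunLike.congr_fun (Ring.inverse_mul_cancel _ (α.isUnit_one_sub hw)) x
  rw [transferFunction, add_apply, comp_apply, comp_apply, comp_apply, hx, add_comm]
  exact h2

/-- For vectors in the eigenspaces of the colligation operator for `-1` and `1`, the transfer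
function is the Cayley transform of the relation `g ↦ k`. -/
theorem transferFunction_add {w : Fin N → ℂ} (hw : w ∈ polydisk N) {t : α.State} {g k : U}
    (h₁ : α.op (WithLp.toLp 2 (t, g)) = -WithLp.toLp 2 (t, g))
    (h₂ : α.op (WithLp.toLp 2 (-α.P (cayleyVar w) t, k)) =
      WithLp.toLp 2 (-α.P (cayleyVar w) t, k)) :
    α.transferFunction w (k + g) = k - g := by
  -- Coordinatewise this is w(z + 1) = z - 1 for z = (1 + w)/(1 - w).
  have hP : α.P w (-α.P (cayleyVar w) t - t) = -α.P (cayleyVar w) t + t := by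
    ext j
    have hj : 1 - w j ≠ 0 := one_sub_ne_zero_of_norm_lt_one (hw j)
    rw [P_apply, PiLp.sub_apply, PiLp.add_apply, PiLp.neg_apply, P_apply, ← neg_smul]
    nth_rw 2 [← one_smul ℂ (t j)]
    nth_rw 4 [← one_smul ℂ (t j)]
    rw [← sub_smul, ← add_smul, smul_smul]
    congr 1
    rw [cayleyVar]
    field_simp
    ring
  refine α.transferFunction_apply hw (x := -α.P (cayleyVar w) t - t) ?_
  have e : (WithLp.toLp 2 (α.P w (-α.P (cayleyVar w) t - t), k + g) : WithLp 2 (α.State × U)) =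
      WithLp.toLp 2 (-α.P (cayleyVar w) t, k) + WithLp.toLp 2 (t, g) := by
    rw [hP, ← WithLp.toLp_add]; rfl
  rw [e, map_add, h₁, h₂, ← sub_eq_add_neg, ← WithLp.toLp_sub]
  rfl

/-- If the transfer function of `α` is linked to `f` by the Cayley transform, it is the double
Cayley transform of `f`. -/
theorem eqOn_doubleCayley {f : (Fin N → ℂ) → (U →L[ℂ] U)} (hf : IsBessmertnyi f)
    (h : ∀ w ∈ polydisk N, ∀ g : U,
      α.transferFunction w (f (cayleyVar w) g + g) = f (cayleyVar w) g - g) :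
    Set.EqOn α.transferFunction (doubleCayley f) (polydisk N) := by
  intro w hw
  have hu := hf.isUnit_add_one (cayleyVar_mem hw)
  have h' : α.transferFunction w * (f (cayleyVar w) + 1) = f (cayleyVar w) - 1 :=
    ContinuousLinearMap.ext fun g => h w hw g
  rw [doubleCayley, ← h', Ring.mul_inverse_cancel_right _ _ hu]

/-! ### From a self-adjoint colligation to a Bessmertnyĭ pencil -/

section Realization

/-- The vectors of the state space which are eigenvectors of the colligation operator for `-1`. -/
def negEigenspace : Submodule ℂ α.State :=
  LinearMap.ker ((α.op + 1) ∘L incl₁ : α.State →L[ℂ] WithLp 2 (α.State × U)).toLinearMap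

theorem mem_negEigenspace {t : α.State} :
    t ∈ α.negEigenspace ↔ α.op (WithLp.toLp 2 (t, 0)) = -WithLp.toLp 2 (t, 0) :=
  LinearMap.mem_ker.trans add_eq_zero_iff_eq_neg

instance : CompleteSpace α.negEigenspace :=
  (ContinuousLinearMap.isClosed_ker
    ((α.op + 1) ∘L incl₁ : α.State →L[ℂ] WithLp 2 (α.State × U))).completeSpace_coe

/-- The state component of the eigenvector of the colligation operator for `-1` with input
component `g`, up to a vector `h` with input component zero. -/
def eigenState : WithLp 2 (U × α.negEigenspace) →L[ℂ] α.State :=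
  α.negEigenspace.subtypeL ∘L WithLp.sndL 2 ℂ U α.negEigenspace -
    α.B ∘L Ring.inverse (1 - α.D) ∘L WithLp.fstL 2 ℂ U α.negEigenspace

theorem eigenState_apply (g : U) (h : α.negEigenspace) :
    α.eigenState (WithLp.toLp 2 (g, h)) = h - α.B (Ring.inverse (1 - α.D) g) := rfl

/-- The coefficients of the pencil of the Bessmertnyi realization obtained from `α`. -/
def coeff (k : Fin N) : WithLp 2 (U × α.negEigenspace) →L[ℂ] WithLp 2 (U × α.negEigenspace) :=
  adjoint α.eigenState ∘L α.proj k ∘L α.eigenState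

theorem isPositive_coeff (k : Fin N) : (α.coeff k).IsPositive := by
  rw [isPositive_iff_complex]
  intro x
  have h : inner ℂ (α.coeff k x) x = ((‖α.eigenState x k‖ ^ 2 : ℝ) : ℂ) := by
    rw [coeff, comp_apply, adjoint_inner_left, comp_apply, inner_proj, inner_self_eq_norm_sq_to_K]
    simp
  rw [h]
  exact ⟨rfl, sq_nonneg _⟩

theorem pencil_coeff (z : Fin N → ℂ) :
    pencil α.coeff z = adjoint α.eigenState ∘L α.P z ∘L α.eigenState := by
  ext1 x
  simp [pencil, coeff, P, sum_apply]

theorem inner_pencil_coeff (z : Fin N → ℂ) (x y : WithLp 2 (U × α.negEigenspace)) :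
    inner ℂ (pencil α.coeff z x) y = inner ℂ (α.P z (α.eigenState x)) (α.eigenState y) := by
  rw [pencil_coeff, comp_apply, adjoint_inner_left, comp_apply]

/-- On vectors (0, h), `eigenState` is the inclusion, so the form of this block is that of P(z)
restricted to a subspace. The unimodular factor leaves its modulus unchanged, and a positive lower
bound for the real parts makes it coercive. -/
theorem isUnit_block₂₂_pencil_coeff {z : Fin N → ℂ} (hz : z ∈ Omega N) :
    IsUnit (block₂₂ (pencil α.coeff z)) := by
  obtain ⟨l, hl, x, hx, rfl⟩ := hz
  obtain ⟨r, hr, hrx⟩ := exists_pos_le_re hx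
  refine isUnit_of_forall_le_norm_inner_map _ (c := ⟨r, hr.le⟩) hr fun h => ?_
  have hP (y : α.State) : α.P (l • x) y = l • α.P x y := by
    ext j
    rw [PiLp.smul_apply, P_apply, P_apply, Pi.smul_apply, smul_assoc]
  have he : α.eigenState (WithLp.toLp 2 (0, h)) = h := by
    rw [eigenState_apply, map_zero, map_zero, sub_zero]
  rw [inner_block₂₂, inner_pencil_coeff, he, hP, inner_smul_left, norm_mul, RCLike.norm_conj, hl,
    one_mul, mul_comm]
  exact α.le_norm_inner_P hrx h

/-- The function of the Bessmertnyi class obtained from `α`. -/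
def bessmertnyi (z : Fin N → ℂ) : U →L[ℂ] U := schurComplement (pencil α.coeff z)

theorem isBessmertnyi_bessmertnyi : IsBessmertnyi α.bessmertnyi := by
  refine ⟨fun z hz => ?_, α.negEigenspace, inferInstance, inferInstance, inferInstance, α.coeff,
    α.isPositive_coeff, fun z hz => ⟨α.isUnit_block₂₂_pencil_coeff hz, rfl⟩⟩
  have hp : Differentiable ℂ (pencil α.coeff) :=
    Differentiable.fun_sum fun k _ => (differentiable_apply k).smul_const _
  exact (hp.differentiableAt.schurComplement
    (α.isUnit_block₂₂_pencil_coeff hz)).differentiableWithinAt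

variable {α}

theorem op_op (hα : IsSelfAdjoint α.op) (v : WithLp 2 (α.State × U)) : α.op (α.op v) = v := by
  have h := Unitary.star_mul_self_of_mem α.unitary_op
  rw [hα.star_eq] at h
  exact DFunLike.congr_fun h v

/-- Since `α.op` is an involution, 1 - `α.op` maps into the eigenspace for `-1`. Its value at (0, u)
is (-Bu, (1 - D)u), and u = (1 - D)⁻¹g gives input component g. -/
theorem op_eigenState (hα : IsSelfAdjoint α.op) (hD : IsUnit (1 - α.D)) (g : U)
    (h : α.negEigenspace) :
    α.op (WithLp.toLp 2 (α.eigenState (WithLp.toLp 2 (g, h)), g)) =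
      -WithLp.toLp 2 (α.eigenState (WithLp.toLp 2 (g, h)), g) := by
  set u := Ring.inverse (1 - α.D) g with hu
  have hg : u - α.D u = g := DFunLike.congr_fun (Ring.mul_inverse_cancel _ hD) g
  have e : (WithLp.toLp 2 (α.eigenState (WithLp.toLp 2 (g, h)), g) : WithLp 2 (α.State × U)) =
      WithLp.toLp 2 ((h : α.State), 0) + (WithLp.toLp 2 (0, u) - α.op (WithLp.toLp 2 (0, u))) := by
    rw [apply_toLp, map_zero, map_zero, zero_add, zero_add, ← WithLp.toLp_sub, ← WithLp.toLp_add,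
      eigenState_apply, ← hu, Prod.mk_sub_mk, Prod.mk_add_mk, zero_sub, zero_add, ← sub_eq_add_neg]
    congr 2
    exact hg.symm
  rw [e, map_add, map_sub, op_op hα, mem_negEigenspace _ |>.1 h.2]
  abel

/-- Two eigenvectors with the same input component differ by one with input component zero, so
`eigenState` parametrizes the whole eigenspace. -/
theorem exists_eigenState_eq (hα : IsSelfAdjoint α.op) (hD : IsUnit (1 - α.D)) {s : α.State} {g : U}
    (hs : α.op (WithLp.toLp 2 (s, g)) = -WithLp.toLp 2 (s, g)) :
    ∃ h : α.negEigenspace, α.eigenState (WithLp.toLp 2 (g, h)) = s := by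
  have h0 := op_eigenState hα hD g 0
  have hm : s - α.eigenState (WithLp.toLp 2 (g, 0)) ∈ α.negEigenspace := by
    have e : (WithLp.toLp 2 (s - α.eigenState (WithLp.toLp 2 (g, 0)), 0) :
        WithLp 2 (α.State × U)) =
        WithLp.toLp 2 (s, g) - WithLp.toLp 2 (α.eigenState (WithLp.toLp 2 (g, 0)), g) := by
      refine congrArg (WithLp.toLp 2) (Prod.ext rfl ?_)
      exact (sub_self g).symm
    rw [mem_negEigenspace, e, map_sub, hs, h0]
    abel
  refine ⟨⟨_, hm⟩, ?_⟩
  simp [eigenState_apply]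

/-- A vector orthogonal to the eigenspace of the colligation operator for `-1` is fixed. -/
theorem op_eq_self (hα : IsSelfAdjoint α.op) {v : WithLp 2 (α.State × U)}
    (h : ∀ e, α.op e = -e → inner ℂ v e = 0) : α.op v = v := by
  have he : α.op (v - α.op v) = -(v - α.op v) := by
    rw [map_sub, op_op hα]
    abel
  have h2 : inner ℂ (α.op v) (v - α.op v) = inner ℂ v (α.op (v - α.op v)) := by
    rw [← adjoint_inner_left, hα.adjoint_eq]
  have h3 : inner ℂ (v - α.op v) (v - α.op v) = 0 := by
    rw [inner_sub_left, h2, he, inner_neg_right, h _ he]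
    simp
  exact (sub_eq_zero.mp (inner_self_eq_zero.mp h3)).symm

theorem eqOn_doubleCayley_bessmertnyi (hα : IsSelfAdjoint α.op) (hD : IsUnit (1 - α.D)) :
    Set.EqOn α.transferFunction (doubleCayley α.bessmertnyi) (polydisk N) := by
  refine α.eqOn_doubleCayley α.isBessmertnyi_bessmertnyi fun w hw g => ?_
  have hz := polyhalfplane_subset N (cayleyVar_mem hw)
  have hT := apply_toLp_neg_inverse (α.isUnit_block₂₂_pencil_coeff hz) g
  refine α.transferFunction_add hw
    (op_eigenState hα hD g (-(Ring.inverse (block₂₂ (pencil α.coeff (cayleyVar w))))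
      (block₂₁ (pencil α.coeff (cayleyVar w)) g))) (op_eq_self hα fun e he => ?_)
  obtain ⟨⟨s, g'⟩⟩ := e
  obtain ⟨h', rfl⟩ := exists_eigenState_eq hα hD he
  -- The pencil sends the chosen vector to (f(z)g, 0), so the state and input contributions cancel.
  rw [WithLp.prod_inner_apply, inner_neg_left, ← inner_pencil_coeff, hT, WithLp.prod_inner_apply]
  simp [bessmertnyi]

end Realization

/-! ### Colligations from reflections -/

section OfSubmodule

variable {X : Fin N → Type u} [∀ k, NormedAddCommGroup (X k)] [∀ k, InnerProductSpace ℂ (X k)]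
  [∀ k, CompleteSpace (X k)] (E : Submodule ℂ (WithLp 2 (PiLp 2 X × U)))
  [E.HasOrthogonalProjection]

theorem isSelfAdjoint_one_sub_starProjection_add_self :
    IsSelfAdjoint (1 - (E.starProjection + E.starProjection)) :=
  (IsSelfAdjoint.one _).sub (isStarProjection_starProjection.isSelfAdjoint.add
    isStarProjection_starProjection.isSelfAdjoint)

/-- The colligation whose operator is the reflection in the orthogonal complement of `E`. -/
def ofSubmodule : AglerUnitaryColligation N U where
  X := X
  op := 1 - (E.starProjection + E.starProjection)
  unitary_op := by
    refine mem_unitary_of_isSelfAdjoint (isSelfAdjoint_one_sub_starProjection_add_self E) ?_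
    have h : E.starProjection * E.starProjection = E.starProjection :=
      isStarProjection_starProjection.isIdempotentElem
    simp only [mul_sub, sub_mul, add_mul, mul_add, h, one_mul, mul_one]
    abel

theorem ofSubmodule_op_of_mem {v : WithLp 2 (PiLp 2 X × U)} (hv : v ∈ E) :
    (ofSubmodule E).op v = -v := by
  change v - (E.starProjection v + E.starProjection v) = -v
  rw [Submodule.starProjection_eq_self_iff.mpr hv]
  abel

theorem ofSubmodule_op_of_mem_orthogonal {v : WithLp 2 (PiLp 2 X × U)} (hv : v ∈ Eᗮ) :
    (ofSubmodule E).op v = v := by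
  change v - (E.starProjection v + E.starProjection v) = v
  rw [(Submodule.starProjection_apply_eq_zero_iff E).mpr hv]
  abel

end OfSubmodule

end AglerUnitaryColligation

/-! ### From a Bessmertnyĭ pencil to a self-adjoint colligation -/

section Factorization

variable {N : ℕ} {E : Type u} [NormedAddCommGroup E] [InnerProductSpace ℂ E] [CompleteSpace E]

theorem exists_isSelfAdjoint_mul_self {T : E →L[ℂ] E} (hT : T.IsPositive) :
    ∃ S : E →L[ℂ] E, IsSelfAdjoint S ∧ S * S = T :=
  have h : 0 ≤ T := (nonneg_iff_isPositive T).mpr hT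
  ⟨CFC.sqrt T, (CFC.sqrt_nonneg T).isSelfAdjoint, CFC.sqrt_mul_sqrt_self T h⟩

end Factorization

variable {N : ℕ} {U : Type u} [NormedAddCommGroup U] [InnerProductSpace ℂ U] [CompleteSpace U]

/-- The double Cayley transform of a function of the Bessmertnyi class is the transfer function of
a colligation with self-adjoint operator. -/
theorem IsBessmertnyi.exists_colligation {f : (Fin N → ℂ) → (U →L[ℂ] U)} (hf : IsBessmertnyi f) :
    ∃ α : AglerUnitaryColligation N U, IsSelfAdjoint α.op ∧
      Set.EqOn α.transferFunction (doubleCayley f) (polydisk N) := by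
  obtain ⟨-, H, _, _, _, A, hA, hfA⟩ := id hf
  choose S hS hSA using fun k => exists_isSelfAdjoint_mul_self (hA k)
  let X : Fin N → Type u := fun _ => WithLp 2 (U × H)
  -- Stacking the square roots gives ψ*P(z)ψ = A(z), with one copy of U ⊕ H for each variable.
  let ψ : WithLp 2 (U × H) →L[ℂ] PiLp 2 X :=
    (PiLp.continuousLinearEquiv 2 ℂ X).symm.toContinuousLinearMap ∘L ContinuousLinearMap.pi S
  let Φ : WithLp 2 (U × H) →L[ℂ] WithLp 2 (PiLp 2 X × U) :=
    incl₁ ∘L ψ + incl₂ ∘L WithLp.fstL 2 ℂ U H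
  have hΦ (v : WithLp 2 (U × H)) : Φ v = WithLp.toLp 2 (ψ v, v.fst) := by
    change WithLp.toLp 2 (ψ v, 0) + WithLp.toLp 2 (0, v.fst) = _
    rw [← WithLp.toLp_add, Prod.mk_add_mk, add_zero, zero_add]
  -- The closure is needed for the orthogonal projection; orthogonality to it can still be tested on
  -- the range.
  let E := Φ.range.topologicalClosure
  have : CompleteSpace E := Φ.range.isClosed_topologicalClosure.completeSpace_coe
  have hE (p : PiLp 2 X) (k : U)
      (h : ∀ v', inner ℂ p (ψ v') = inner ℂ (WithLp.toLp 2 (k, (0 : H))) v') :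
      WithLp.toLp 2 (-p, k) ∈ Eᗮ := by
    rw [Submodule.orthogonal_closure, Submodule.mem_orthogonal']
    rintro _ ⟨v', rfl⟩
    change inner ℂ _ (Φ v') = 0
    rw [hΦ, WithLp.prod_inner_apply, inner_neg_left, h, WithLp.prod_inner_apply]
    simp
  let α : AglerUnitaryColligation N U := .ofSubmodule E
  have hψ (z : Fin N → ℂ) (v v' : WithLp 2 (U × H)) :
      inner ℂ (α.P z (ψ v)) (ψ v') = inner ℂ (pencil A z v) v' := by
    refine (α.inner_P z (ψ v) (ψ v')).trans ?_
    rw [pencil, sum_apply, sum_inner]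
    refine Finset.sum_congr rfl fun k _ => ?_
    rw [smul_apply, inner_smul_left, ← hSA]
    congr 1
    change inner ℂ (S k v) (S k v') = inner ℂ (S k (S k v)) v'
    conv_rhs => rw [← (hS k).adjoint_eq, adjoint_inner_left, (hS k).adjoint_eq]
  refine ⟨α, AglerUnitaryColligation.isSelfAdjoint_one_sub_starProjection_add_self E,
    α.eqOn_doubleCayley hf fun w hw g => ?_⟩
  obtain ⟨hu, hfz⟩ := hfA _ (polyhalfplane_subset N (cayleyVar_mem hw))
  have hT := apply_toLp_neg_inverse hu g
  set v : WithLp 2 (U × H) := WithLp.toLp 2 (g, -(Ring.inverse (block₂₂ (pencil A (cayleyVar w))))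
    (block₂₁ (pencil A (cayleyVar w)) g)) with hv
  rw [show schurComplement (pencil A (cayleyVar w)) = f (cayleyVar w) from hfz.symm] at hT
  refine α.transferFunction_add hw (t := ψ v) (AglerUnitaryColligation.ofSubmodule_op_of_mem E ?_)
    (AglerUnitaryColligation.ofSubmodule_op_of_mem_orthogonal E ?_)
  · exact Φ.range.le_topologicalClosure ⟨v, hΦ v⟩
  · exact hE _ _ fun v' => (hψ _ v v').trans (by rw [hT])

end Bessmertnyi

end

theorem mainTheorem5 {N : ℕ} {U : Type*} [NormedAddCommGroup U] [InnerProductSpace ℂ U]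
    [CompleteSpace U] (F : (Fin N → ℂ) → (U →L[ℂ] U))
    (hF : DifferentiableOn ℂ F (Bessmertnyi.polydisk N)) :
    (∃ f : (Fin N → ℂ) → (U →L[ℂ] U), Bessmertnyi.IsBessmertnyi f ∧
        Set.EqOn F (Bessmertnyi.doubleCayley f) (Bessmertnyi.polydisk N)) ↔
      (∃ α : Bessmertnyi.AglerUnitaryColligation N U, IsSelfAdjoint α.op ∧
        Set.EqOn F α.transferFunction (Bessmertnyi.polydisk N)) ∧
      (1 : ℂ) ∉ spectrum ℂ (F 0) := by
  have h0 : (0 : Fin N → ℂ) ∈ Bessmertnyi.polydisk N := fun k => by simp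
  constructor
  · rintro ⟨f, hf, hFf⟩
    obtain ⟨α, hα, hαf⟩ := hf.exists_colligation
    refine ⟨⟨α, hα, hFf.trans hαf.symm⟩, ?_⟩
    have hu := hf.isUnit_add_one (Bessmertnyi.cayleyVar_mem h0)
    rw [spectrum.notMem_iff, map_one, hFf h0, Bessmertnyi.doubleCayley]
    set T := f (Bessmertnyi.cayleyVar 0)
    -- Condition (ii) holds because 1 - F(0) is twice an inverse, hence invertible.
    have h : 1 - (T - 1) * Ring.inverse (T + 1) = (2 : ℂ) • Ring.inverse (T + 1) := by
      nth_rw 1 [← Ring.mul_inverse_cancel _ hu]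
      rw [← sub_mul, add_sub_sub_cancel, one_add_one_eq_two, two_smul, two_mul]
    rw [h]
    exact hu.ringInverse.smul (Units.mk0 (2 : ℂ) two_ne_zero)
  · rintro ⟨⟨α, hα, hFα⟩, h1⟩
    rw [spectrum.notMem_iff, map_one, hFα h0] at h1
    rw [α.transferFunction_zero] at h1
    exact ⟨α.bessmertnyi, α.isBessmertnyi_bessmertnyi, hFα.trans
      (Bessmertnyi.AglerUnitaryColligation.eqOn_doubleCayley_bessmertnyi hα h1)⟩
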